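/- Let $n,m\ge 0$ be integers, let $0\le k\le\min\{n,m\}$ be an integer, and let $\tau>0$. Let $\Sigma_0=\Omega\Lambda\Omega^\top$ with $\Omega\in\mathbb{R}^{n\times n}$ orthogonal and $\Lambda=\mathrm{diag}(\lambda_1,\dots,\lambda_n)$, $\lambda_1>\lambda_2>\dots>\lambda_n>0$. For $W\in\mathbb{R}^{n\times m}$ put $$L^1_\tau(W)=\mathcal{B}^2(WW^\top+\tau I_n,\Sigma_0),\qquad \mathcal{B}^2(\Sigma,\Sigma_0)=\mathrm{tr}\Big(\Sigma+\Sigma_0-2\big(\Sigma_0^{1/2}\Sigma\Sigma_0^{1/2}\big)^{1/2}\Big),$$ where $A^{1/2}$ is the positive semidefinite square root. Let $\mathcal{M}(k)$ be the manifold of $n\times m$ real matrices of rank $k$ and $\mathcal{M}(\leqslant k)$ the set of those of rank at most $k$. A point $W\in\mathcal{M}(k)$ is a critical point of $L^1_\tau|_{\mathcal{M}(k)}$ if the differential of this restriction at $W$ vanishes on the tangent space $T_W\mathcal{M}(k)$. For $J\subseteq[n]$ with $|J|=k$, let $\Omega_J\in\mathbb{R}^{n\times k}$ consist of the columns of $\Omega$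 with index in $J$, and let $\bar\Lambda_J\in\mathbb{R}^{k\times k}$ be the diagonal submatrix of $\Lambda$ with rows and columns in $J$. 1. A point $W\in\mathcal{M}(k)$ is a critical point of $L^1_\tau|_{\mathcal{M}(k)}$ if and only if $W=\Omega_J(\bar\Lambda_J-\tau I_k)^{1/2}V^\top$ for some $J\subseteq[n]$ with $|J|=k$ and $\tau\le\lambda_j$ for all $j\in J$, and some $V\in\mathbb{R}^{m\times k}$ with $V^\top V=I_k$. 2. For every such $J$ and $V$, $\;L^1_\tau\big(\Omega_J(\bar\Lambda_J-\tau I_k)^{1/2}V^\top\big)=\sum_{j\notin J}(\sqrt{\lambda_j}-\sqrt{\tau})^2$. 3. If $\tau\le\lambda_i$ for all $i\le k$, then the minimum of $L^1_\tau$ over $\mathcal{M}(\leqslant k)$ exists, equals $\sum_{j>k}(\sqrt{\lambda_j}-\sqrt\tau)^2$, and is attained at $W\in\mathcal{M}(\leqslant k)$ exactly when $W=\Omega_{[k]}(\bar\Lambda_{[k]}-\tau I_k)^{1/2}V^\top$ for some $V\in\mathbb{R}^{m\times k}$ with $V^\top V=I_k$. 4. If $\tau<\lambda_i$ for all $i\le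 k$, then moreover the infimum of $L^1_\tau$ over $\mathcal{M}(k)$ is attained, and $\min_{\mathcal{M}(k)}L^1_\tau=\min_{\mathcal{M}(\leqslant k)}L^1_\tau$. -/

import Mathlib

open scoped Matrix

noncomputable section

namespace BuresWasserstein

section Criticality

open scoped ContDiff

variable {E : Type*} [NormedAddCommGroup E] [NormedSpace ℝ E]

/-- Tangent vectors at `x` to a subset `M` of a normed space (an embedded submanifold in all
uses): velocities at time `0` of smooth curves `(-ε, ε) → M` passing through `x` at time `0`. -/
def tangentVectors (M : Set E) (x : E) : Set E :=
  {v | ∃ (γ : ℝ → E) (ε : ℝ), 0 < ε ∧ ContDiffOn ℝ ∞ γ (Set.Ioo (-ε) ε) ∧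
    (∀ t ∈ Set.Ioo (-ε) ε, γ t ∈ M) ∧ γ 0 = x ∧ HasDerivAt γ v 0}

/-- `x ∈ M` is a critical point of the restriction `f|_M` : the restriction is differentiable
at `x` (that is, `f y = f x + f' (y - x) + o(‖y - x‖)` for `y ∈ M`, with a linear map `f'`), and its
differential, the restriction of `f'` to the tangent space, is the zero function. -/
def IsCriticalPointOn (f : E → ℝ) (M : Set E) (x : E) : Prop :=
  x ∈ M ∧ ∃ f' : E →L[ℝ] ℝ, HasFDerivWithinAt f f' M x ∧ ∀ v ∈ tangentVectors M x, f' v = 0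

end Criticality

/-- The manifold of `n × m` real matrices of rank `k`. -/
def rankEq (n m k : ℕ) : Set (Matrix (Fin n) (Fin m) ℝ) := {W | W.rank = k}

/-- The set of `n × m` real matrices of rank at most `k`. -/
def rankLE (n m k : ℕ) : Set (Matrix (Fin n) (Fin m) ℝ) := {W | W.rank ≤ k}

section Frobenius

open scoped Matrix.Norms.Frobenius

/-- `W` is a critical point of the restriction of `f` to the manifold of rank-`k` matrices, as a
submanifold of the space of `n × m` matrices with the Frobenius norm. -/
def IsCriticalOnRank {n m : ℕ} (f : Matrix (Fin n) (Fin m) ℝ → ℝ) (k : ℕ)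
    (W : Matrix (Fin n) (Fin m) ℝ) : Prop :=
  IsCriticalPointOn f (rankEq n m k) W

end Frobenius

section Loss

open scoped MatrixOrder

/-- The positive semidefinite square root of a positive semidefinite matrix. -/
def psdSqrt {n : ℕ} (A : Matrix (Fin n) (Fin n) ℝ) : Matrix (Fin n) (Fin n) ℝ := CFC.sqrt A

/-- The squared Bures-Wasserstein distance of two positive semidefinite matrices. -/
def bwSq {n : ℕ} (S S₀ : Matrix (Fin n) (Fin n) ℝ) : ℝ :=
  (S + S₀ - (2 : ℝ) • psdSqrt (psdSqrt S₀ * S * psdSqrt S₀)).trace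

/-- The smoothed loss `W ↦ B²(W Wᵀ + τ I, S₀)`. -/
def smoothedLoss {n m : ℕ} (τ : ℝ) (S₀ : Matrix (Fin n) (Fin n) ℝ)
    (W : Matrix (Fin n) (Fin m) ℝ) : ℝ :=
  bwSq (W * Wᵀ + τ • (1 : Matrix (Fin n) (Fin n) ℝ)) S₀

end Loss

/-- The `n × k` submatrix of the columns with index in `J`. -/
def colSub {n k : ℕ} (A : Matrix (Fin n) (Fin n) ℝ) (J : Finset (Fin n)) (hJ : J.card = k) :
    Matrix (Fin n) (Fin k) ℝ :=
  A.submatrix id (J.orderEmbOfFin hJ)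

/-- The `k × k` submatrix of the rows and columns with index in `J`. -/
def principalSub {n k : ℕ} (A : Matrix (Fin n) (Fin n) ℝ) (J : Finset (Fin n)) (hJ : J.card = k) :
    Matrix (Fin k) (Fin k) ℝ :=
  A.submatrix (J.orderEmbOfFin hJ) (J.orderEmbOfFin hJ)

/-- The matrix `Ω_J (Λ̄_J - τ I_k)^{1/2} Vᵀ`; meaningful when `τ ≤ λ_j` for all `j ∈ J`. -/
def candidate {n m k : ℕ} (τ : ℝ) (Ω Λ : Matrix (Fin n) (Fin n) ℝ) (J : Finset (Fin n))
    (hJ : J.card = k) (V : Matrix (Fin m) (Fin k) ℝ) : Matrix (Fin n) (Fin m) ℝ :=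
  colSub Ω J hJ * psdSqrt (principalSub Λ J hJ - τ • (1 : Matrix (Fin k) (Fin k) ℝ)) * Vᵀ

/-- The set of the first `k` of the `n` indices. -/
def firstIndices (n k : ℕ) : Finset (Fin n) := Finset.univ.filter fun i => (i : ℕ) < k

theorem card_firstIndices {n k : ℕ} (h : k ≤ n) : (firstIndices n k).card = k := by
  rw [firstIndices, Fin.card_filter_val_lt, min_eq_right h]

end BuresWasserstein

end

/-! Let `G` be the transport map at `W`. The loss is differentiable with derivative `H ↦ 2 tr(Wᵀ (1
- G) H)`. The curves `(1 + tY) W` keep the rank for small `t`, and testing against all `Y` gives `W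
Wᵀ (1 - G) = 0`, that is, `G W = W`. Conversely `G W = W` kills the whole derivative, so criticality
on the rank-`k` manifold is this fixed-point equation.

Since `G (W Wᵀ + τ) G = S₀`, the equation yields `S₀ C = C² + τ C` for `C = W Wᵀ`. The right side is
symmetric, so `C` commutes with `S₀`. As the `λ_i` are distinct, `C` is diagonal in the basis `Ω`,
and each eigenvalue `d_i` is `0` or `λ_i - τ`. The loss becomes `∑ (√λ_i - √(d_i + τ))²`, where the
chosen indices contribute nothing. The factor `V` is the remaining freedom in `W` once `W Wᵀ` is
known.

For the minimum, coercivity on the closed set of rank at most `k` gives a minimizer. It satisfies `G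
W = W` too, because `(1 + tY) W` never has larger rank than `W`. Only a comparison of index sets
remains: `(√x - √τ)²` increases on `x ≥ τ`, so the first `k` indices are the best to choose. -/

noncomputable section

namespace BuresWasserstein

/-! ### Positive semidefinite square roots -/

section Sqrt

open scoped MatrixOrder

variable {n : ℕ}

theorem psdSqrt_posSemidef (A : Matrix (Fin n) (Fin n) ℝ) : (psdSqrt A).PosSemidef :=
  Matrix.nonneg_iff_posSemidef.1 (CFC.sqrt_nonneg A)

theorem psdSqrt_mul_self {A : Matrix (Fin n) (Fin n) ℝ} (hA : A.PosSemidef) :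
    psdSqrt A * psdSqrt A = A :=
  CFC.sqrt_mul_sqrt_self A (Matrix.nonneg_iff_posSemidef.2 hA)

theorem psdSqrt_eq_of_mul_self {A B : Matrix (Fin n) (Fin n) ℝ} (hB : B.PosSemidef)
    (h : B * B = A) : psdSqrt A = B :=
  CFC.sqrt_unique h (Matrix.nonneg_iff_posSemidef.2 hB)

theorem psdSqrt_transpose (A : Matrix (Fin n) (Fin n) ℝ) : (psdSqrt A)ᵀ = psdSqrt A := by
  have h := (psdSqrt_posSemidef A).isHermitian
  rwa [Matrix.IsHermitian, Matrix.conjTranspose_eq_transpose_of_trivial] at h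

theorem isUnit_det_psdSqrt {A : Matrix (Fin n) (Fin n) ℝ} (hA : A.PosDef) :
    IsUnit (psdSqrt A).det := by
  have h : (psdSqrt A).det * (psdSqrt A).det = A.det := by
    rw [← Matrix.det_mul, psdSqrt_mul_self hA.posSemidef]
  refine isUnit_iff_ne_zero.2 fun h0 => hA.det_pos.ne' ?_
  rw [← h, h0, mul_zero]

end Sqrt

/-! ### The transport map -/

section Loss

variable {n m : ℕ}

/-- The matrix `S₀^{1/2} (W Wᵀ + τ I) S₀^{1/2}`, whose square root enters the loss. -/
def conjCov (τ : ℝ) (S₀ : Matrix (Fin n) (Fin n) ℝ) (W : Matrix (Fin n) (Fin m) ℝ) :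
    Matrix (Fin n) (Fin n) ℝ :=
  psdSqrt S₀ * (W * Wᵀ + τ • (1 : Matrix (Fin n) (Fin n) ℝ)) * psdSqrt S₀

/-- The optimal transport map between the centred Gaussians with covariances `W Wᵀ + τ I`
and `S₀`. -/
def transportMap (τ : ℝ) (S₀ : Matrix (Fin n) (Fin n) ℝ) (W : Matrix (Fin n) (Fin m) ℝ) :
    Matrix (Fin n) (Fin n) ℝ :=
  psdSqrt S₀ * (psdSqrt (conjCov τ S₀ W))⁻¹ * psdSqrt S₀

theorem posDef_cov {τ : ℝ} (hτ : 0 < τ) (W : Matrix (Fin n) (Fin m) ℝ) :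
    (W * Wᵀ + τ • (1 : Matrix (Fin n) (Fin n) ℝ)).PosDef := by
  refine Matrix.PosDef.posSemidef_add ?_ (Matrix.PosDef.one.smul hτ)
  have := Matrix.posSemidef_self_mul_conjTranspose W
  rwa [Matrix.conjTranspose_eq_transpose_of_trivial] at this

theorem posDef_conjCov {τ : ℝ} (hτ : 0 < τ) {S₀ : Matrix (Fin n) (Fin n) ℝ} (hS₀ : S₀.PosDef)
    (W : Matrix (Fin n) (Fin m) ℝ) : (conjCov τ S₀ W).PosDef := by
  have hu : IsUnit (psdSqrt S₀) := (Matrix.isUnit_iff_isUnit_det _).2 (isUnit_det_psdSqrt hS₀)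
  have h := (Matrix.IsUnit.posDef_star_right_conjugate_iff hu).2 (posDef_cov hτ W)
  rwa [Matrix.star_eq_conjTranspose, Matrix.conjTranspose_eq_transpose_of_trivial, psdSqrt_transpose] at h

theorem smoothedLoss_eq (τ : ℝ) (S₀ : Matrix (Fin n) (Fin n) ℝ) (W : Matrix (Fin n) (Fin m) ℝ) :
    smoothedLoss τ S₀ W = (W * Wᵀ).trace + τ * n + S₀.trace
      - 2 * (psdSqrt (conjCov τ S₀ W)).trace := by
  simp [smoothedLoss, bwSq, conjCov, Matrix.trace_add, Matrix.trace_sub, Matrix.trace_smul]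

theorem transportMap_transpose (τ : ℝ) (S₀ : Matrix (Fin n) (Fin n) ℝ)
    (W : Matrix (Fin n) (Fin m) ℝ) : (transportMap τ S₀ W)ᵀ = transportMap τ S₀ W := by
  simp [transportMap, Matrix.transpose_mul, Matrix.transpose_nonsing_inv, psdSqrt_transpose,
    Matrix.mul_assoc]

/-- With `R² = conjCov τ S₀ W`, the inner factor `R⁻¹ R² R⁻¹` cancels. This identity turns the
fixed-point equation into a polynomial one, free of square roots. -/
theorem transportMap_mul_cov_mul {τ : ℝ} (hτ : 0 < τ) {S₀ : Matrix (Fin n) (Fin n) ℝ}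
    (hS₀ : S₀.PosDef) (W : Matrix (Fin n) (Fin m) ℝ) :
    transportMap τ S₀ W * (W * Wᵀ + τ • (1 : Matrix (Fin n) (Fin n) ℝ)) * transportMap τ S₀ W
      = S₀ := by
  have hS := posDef_conjCov hτ hS₀ W
  have hR := psdSqrt_mul_self hS.posSemidef
  have hu := isUnit_det_psdSqrt hS
  set R := psdSqrt (conjCov τ S₀ W) with hRdef
  calc _ = psdSqrt S₀ * (R⁻¹ * conjCov τ S₀ W * R⁻¹) * psdSqrt S₀ := by
        rw [transportMap, ← hRdef, conjCov]; simp only [Matrix.mul_assoc]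
    _ = psdSqrt S₀ * psdSqrt S₀ := by
        rw [← hR, ← Matrix.mul_assoc R⁻¹, Matrix.nonsing_inv_mul _ hu, Matrix.one_mul,
          Matrix.mul_nonsing_inv _ hu, Matrix.mul_one]
    _ = S₀ := psdSqrt_mul_self hS₀.posSemidef

end Loss

/-! ### Differentiability of the loss and the critical point equation -/

section Derivative

open scoped Matrix.Norms.Frobenius

variable {n m : ℕ}

theorem frobenius_norm_sq (W : Matrix (Fin n) (Fin m) ℝ) : ‖W‖ ^ 2 = (W * Wᵀ).trace := by
  rw [Matrix.frobenius_norm_def, ← Real.sqrt_eq_rpow, Real.sq_sqrt (by positivity)]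
  simp [Matrix.trace, Matrix.mul_apply, pow_two]

theorem exists_abs_trace_le (n : ℕ) :
    ∃ C : ℝ, 0 ≤ C ∧ ∀ X : Matrix (Fin n) (Fin n) ℝ, |X.trace| ≤ C * ‖X‖ := by
  have h : ∀ {E : Type} [NormedAddCommGroup E] [NormedSpace ℝ E] [FiniteDimensional ℝ E]
      (f : E →ₗ[ℝ] ℝ), ∃ C : ℝ, 0 ≤ C ∧ ∀ x, |f x| ≤ C * ‖x‖ := fun f =>
    ⟨‖LinearMap.toContinuousLinearMap f‖, norm_nonneg _,
      (LinearMap.toContinuousLinearMap f).le_opNorm⟩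
  exact h (Matrix.traceLinearMap (Fin n) ℝ ℝ)

/-- The square root of matrices is Lipschitz at an invertible one. -/
theorem exists_norm_sub_le_norm_mul_self_sub {R : Matrix (Fin n) (Fin n) ℝ} (hR : R.PosDef) :
    ∃ C : ℝ, 0 ≤ C ∧ ∀ Q : Matrix (Fin n) (Fin n) ℝ, Q.PosSemidef →
      ‖Q - R‖ ≤ C * ‖Q * Q - R * R‖ := by
  obtain ⟨c, hc, htr⟩ := exists_abs_trace_le n
  -- With `D = Q - R`, one has `Q² - R² = QD + DR`, so `tr(D (Q² - R²)) = tr(DQD) + ‖TD‖²`. The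
  -- first term is nonnegative, and `‖TD‖` controls `‖D‖` through `T⁻¹`. Dividing by `‖D‖` gives the
  -- bound.
  set T := psdSqrt R with hT
  have hTT : T * T = R := psdSqrt_mul_self hR.posSemidef
  have hu : IsUnit T.det := isUnit_det_psdSqrt hR
  refine ⟨‖T⁻¹‖ ^ 2 * c, by positivity, fun Q hQ => ?_⟩
  have hRt : Rᵀ = R := by
    simpa [Matrix.IsHermitian, Matrix.conjTranspose_eq_transpose_of_trivial] using hR.isHermitian
  have hQt : Qᵀ = Q := by
    simpa [Matrix.IsHermitian, Matrix.conjTranspose_eq_transpose_of_trivial] using hQ.isHermitian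
  set D := Q - R with hD
  have hDt : Dᵀ = D := by simp [hD, hRt, hQt]
  have hDT : (T * D * (T * D)ᵀ).trace = (D * R * D).trace := by
    rw [Matrix.trace_mul_comm, Matrix.transpose_mul, hDt, psdSqrt_transpose, ← hT, ← hTT]
    simp only [Matrix.mul_assoc]
  have h1 : ‖D‖ ≤ ‖T⁻¹‖ * ‖T * D‖ := by
    calc ‖D‖ = ‖T⁻¹ * (T * D)‖ := by
          rw [← Matrix.mul_assoc, Matrix.nonsing_inv_mul _ hu, Matrix.one_mul]
      _ ≤ _ := Matrix.frobenius_norm_mul _ _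
  have h2 : 0 ≤ (D * Q * D).trace := by
    have := (hQ.mul_mul_conjTranspose_same D).trace_nonneg
    rwa [Matrix.conjTranspose_eq_transpose_of_trivial, hDt] at this
  have h3 : (D * (Q * Q - R * R)).trace = (D * Q * D).trace + (D * R * D).trace := by
    have : D * (Q * Q - R * R) = D * Q * D + D * D * R := by
      rw [hD]; noncomm_ring
    rw [this, Matrix.trace_add, Matrix.mul_assoc D D R, Matrix.trace_mul_comm D (D * R)]
  have h4 : ‖T * D‖ ^ 2 ≤ c * (‖D‖ * ‖Q * Q - R * R‖) := by
    rw [frobenius_norm_sq, hDT]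
    calc _ ≤ (D * (Q * Q - R * R)).trace := by linarith
      _ ≤ _ := (le_abs_self _).trans (htr _)
      _ ≤ _ := by gcongr; exact Matrix.frobenius_norm_mul _ _
  rcases (norm_nonneg D).eq_or_lt with h0 | h0
  · rw [← h0]; positivity
  refine le_of_mul_le_mul_left ?_ h0
  calc ‖D‖ * ‖D‖ ≤ (‖T⁻¹‖ * ‖T * D‖) * (‖T⁻¹‖ * ‖T * D‖) := by gcongr
    _ = ‖T⁻¹‖ ^ 2 * ‖T * D‖ ^ 2 := by ring
    _ ≤ ‖T⁻¹‖ ^ 2 * (c * (‖D‖ * ‖Q * Q - R * R‖)) := by gcongr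
    _ = _ := by ring

/-- The linear form `H ↦ 2 tr(Wᵀ (1 - G) H)`, where `G` is the transport map at `W`. -/
def lossDeriv (τ : ℝ) (S₀ : Matrix (Fin n) (Fin n) ℝ) (W : Matrix (Fin n) (Fin m) ℝ) :
    Matrix (Fin n) (Fin m) ℝ →L[ℝ] ℝ :=
  LinearMap.toContinuousLinearMap
    { toFun := fun H => 2 * (Wᵀ * (1 - transportMap τ S₀ W) * H).trace
      map_add' := fun H K => by rw [Matrix.mul_add, Matrix.trace_add, mul_add]
      map_smul' := fun c H => by
        rw [Matrix.mul_smul, Matrix.trace_smul, smul_eq_mul, RingHom.id_apply, smul_eq_mul]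
        ring }

theorem lossDeriv_apply (τ : ℝ) (S₀ : Matrix (Fin n) (Fin n) ℝ) (W H : Matrix (Fin n) (Fin m) ℝ) :
    lossDeriv τ S₀ W H = 2 * (Wᵀ * (1 - transportMap τ S₀ W) * H).trace := rfl

/-- An exact Taylor formula for the trace of the square root: the first term is linear in `Q² - R²`,
the second quadratic in `Q - R`. By cyclicity of the trace, no derivative of the matrix square root
itself is needed. -/
theorem trace_sub_trace_eq {Q R : Matrix (Fin n) (Fin n) ℝ} (hR : IsUnit R.det) :
    2 * (Q.trace - R.trace) =
      ((Q * Q - R * R) * R⁻¹).trace - ((Q - R) * R⁻¹ * (Q - R)).trace := by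
  have e1 : (Q * Q - R * R) * R⁻¹ = Q * Q * R⁻¹ - R := by
    rw [Matrix.sub_mul, Matrix.mul_nonsing_inv_cancel_right _ _ hR]
  have e2 : (Q - R) * R⁻¹ * (Q - R) = Q * R⁻¹ * Q - Q - Q + R := by
    simp only [Matrix.sub_mul, Matrix.mul_sub, Matrix.mul_nonsing_inv _ hR, Matrix.one_mul,
      Matrix.nonsing_inv_mul_cancel_right _ _ hR]
    abel
  have e3 : (Q * Q * R⁻¹).trace = (Q * R⁻¹ * Q).trace := by
    rw [Matrix.mul_assoc Q R⁻¹, Matrix.mul_assoc, Matrix.trace_mul_comm Q (R⁻¹ * Q),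
      Matrix.trace_mul_comm Q (Q * R⁻¹), Matrix.mul_assoc, Matrix.trace_mul_comm Q (R⁻¹ * Q)]
  rw [e1, e2, Matrix.trace_sub, Matrix.trace_add, Matrix.trace_sub, Matrix.trace_sub, e3]
  ring

theorem conjCov_add_sub (τ : ℝ) (S₀ : Matrix (Fin n) (Fin n) ℝ) (W H : Matrix (Fin n) (Fin m) ℝ) :
    conjCov τ S₀ (W + H) - conjCov τ S₀ W =
      psdSqrt S₀ * (H * Wᵀ + W * Hᵀ + H * Hᵀ) * psdSqrt S₀ := by
  rw [conjCov, conjCov, ← Matrix.sub_mul, ← Matrix.mul_sub, Matrix.transpose_add, Matrix.add_mul,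
    Matrix.mul_add, Matrix.mul_add]
  congr 2
  abel

theorem smoothedLoss_add_sub {τ : ℝ} (hτ : 0 < τ) {S₀ : Matrix (Fin n) (Fin n) ℝ}
    (hS₀ : S₀.PosDef) (W H : Matrix (Fin n) (Fin m) ℝ) :
    smoothedLoss τ S₀ (W + H) - smoothedLoss τ S₀ W - lossDeriv τ S₀ W H =
      (H * Hᵀ * (1 - transportMap τ S₀ W)).trace +
        ((psdSqrt (conjCov τ S₀ (W + H)) - psdSqrt (conjCov τ S₀ W)) *
          (psdSqrt (conjCov τ S₀ W))⁻¹ *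
          (psdSqrt (conjCov τ S₀ (W + H)) - psdSqrt (conjCov τ S₀ W))).trace := by
  have hS := posDef_conjCov hτ hS₀ W
  have key := trace_sub_trace_eq (Q := psdSqrt (conjCov τ S₀ (W + H))) (isUnit_det_psdSqrt hS)
  rw [psdSqrt_mul_self hS.posSemidef, psdSqrt_mul_self (posDef_conjCov hτ hS₀ _).posSemidef,
    conjCov_add_sub] at key
  have hG : (psdSqrt S₀ * (H * Wᵀ + W * Hᵀ + H * Hᵀ) * psdSqrt S₀ *
      (psdSqrt (conjCov τ S₀ W))⁻¹).trace =
      ((H * Wᵀ + W * Hᵀ + H * Hᵀ) * transportMap τ S₀ W).trace := by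
    rw [transportMap, Matrix.mul_assoc, Matrix.mul_assoc, Matrix.trace_mul_comm]
    simp only [Matrix.mul_assoc]
  rw [hG] at key
  rw [smoothedLoss_eq, smoothedLoss_eq, lossDeriv_apply]
  have hGt := transportMap_transpose τ S₀ W
  set G := transportMap τ S₀ W
  have e1 : (W * Hᵀ).trace = (H * Wᵀ).trace := by
    rw [← Matrix.trace_transpose, Matrix.transpose_mul, Matrix.transpose_transpose]
  have e2 : (H * Wᵀ * G).trace = (Wᵀ * G * H).trace := by
    rw [Matrix.mul_assoc, Matrix.trace_mul_comm]
  have e3 : (W * Hᵀ * G).trace = (Wᵀ * G * H).trace := by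
    rw [← Matrix.trace_transpose, Matrix.transpose_mul, Matrix.transpose_mul,
      Matrix.transpose_transpose, hGt, Matrix.mul_assoc Wᵀ, Matrix.trace_mul_comm Wᵀ,
      Matrix.mul_assoc]
  have e4 : (Wᵀ * H).trace = (H * Wᵀ).trace := Matrix.trace_mul_comm _ _
  simp only [Matrix.mul_add, Matrix.add_mul, Matrix.mul_sub, Matrix.sub_mul, Matrix.trace_add,
    Matrix.trace_sub, Matrix.transpose_add, Matrix.mul_one] at key ⊢
  rw [e2, e3] at key
  rw [e1, e4]
  linarith

theorem hasFDerivAt_smoothedLoss {τ : ℝ} (hτ : 0 < τ) {S₀ : Matrix (Fin n) (Fin n) ℝ}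
    (hS₀ : S₀.PosDef) (W : Matrix (Fin n) (Fin m) ℝ) :
    HasFDerivAt (smoothedLoss τ S₀) (lossDeriv τ S₀ W) W := by
  refine hasFDerivAt_iff_isLittleO_nhds_zero.2 ?_
  refine Asymptotics.IsBigO.trans_isLittleO ?_ (Asymptotics.isLittleO_norm_pow_id one_lt_two)
  have hS := posDef_conjCov hτ hS₀ W
  have hR : (psdSqrt (conjCov τ S₀ W)).PosDef :=
    (psdSqrt_posSemidef _).posDef_iff_isUnit.2
      ((Matrix.isUnit_iff_isUnit_det _).2 (isUnit_det_psdSqrt hS))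
  obtain ⟨c, hc, htr⟩ := exists_abs_trace_le n
  obtain ⟨C, hC, hlip⟩ := exists_norm_sub_le_norm_mul_self_sub hR
  set G := transportMap τ S₀ W with hG
  set R := psdSqrt (conjCov τ S₀ W) with hRdef
  set a := ‖psdSqrt S₀‖ with ha
  -- `B` bounds the change of the square root per unit of `‖H‖` when `‖H‖ ≤ 1`; the summand `1`
  -- absorbs `H * Hᵀ`.
  set B := C * (a * (2 * ‖W‖ + 1) * a) with hB
  have hB0 : 0 ≤ B := by positivity
  refine Asymptotics.IsBigO.of_bound (c * ‖1 - G‖ + c * (B * ‖R⁻¹‖ * B)) ?_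
  filter_upwards [Metric.ball_mem_nhds (0 : Matrix (Fin n) (Fin m) ℝ) one_pos] with H hH
  have hH1 : ‖H‖ ≤ 1 := (mem_ball_zero_iff.1 hH).le
  refine (congrArg norm (smoothedLoss_add_sub hτ hS₀ W H)).trans_le ?_
  rw [Real.norm_eq_abs, norm_pow, norm_norm]
  set Q := psdSqrt (conjCov τ S₀ (W + H)) with hQdef
  have hD : ‖Q - R‖ ≤ B * ‖H‖ := by
    refine (hlip Q (psdSqrt_posSemidef _)).trans ?_
    rw [hQdef, hRdef, psdSqrt_mul_self hS.posSemidef,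
      psdSqrt_mul_self (posDef_conjCov hτ hS₀ _).posSemidef, conjCov_add_sub, hB, mul_assoc C]
    refine mul_le_mul_of_nonneg_left ?_ hC
    calc _ ≤ a * ‖H * Wᵀ + W * Hᵀ + H * Hᵀ‖ * a :=
          (Matrix.frobenius_norm_mul _ _).trans (by
            gcongr; exact Matrix.frobenius_norm_mul _ _)
      _ ≤ a * ((2 * ‖W‖ + 1) * ‖H‖) * a := by
          gcongr
          have h1 := Matrix.frobenius_norm_mul H Wᵀ
          have h2 := Matrix.frobenius_norm_mul W Hᵀ
          have h3 := Matrix.frobenius_norm_mul H Hᵀ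
          rw [Matrix.frobenius_norm_transpose] at h1 h2 h3
          have h4 := mul_le_mul_of_nonneg_left hH1 (norm_nonneg H)
          have h5 := norm_add₃_le (a := H * Wᵀ) (b := W * Hᵀ) (c := H * Hᵀ)
          linarith
      _ = _ := by ring
  have t1 : |(H * Hᵀ * (1 - G)).trace| ≤ c * ‖1 - G‖ * ‖H‖ ^ 2 := by
    refine (htr _).trans ?_
    calc c * ‖H * Hᵀ * (1 - G)‖ ≤ c * (‖H‖ * ‖Hᵀ‖ * ‖1 - G‖) := by
          gcongr
          refine (Matrix.frobenius_norm_mul _ _).trans ?_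
          gcongr; exact Matrix.frobenius_norm_mul _ _
      _ = _ := by rw [Matrix.frobenius_norm_transpose]; ring
  have t2 : |((Q - R) * R⁻¹ * (Q - R)).trace| ≤ c * (B * ‖R⁻¹‖ * B) * ‖H‖ ^ 2 := by
    refine (htr _).trans ?_
    calc c * ‖(Q - R) * R⁻¹ * (Q - R)‖ ≤ c * (‖Q - R‖ * ‖R⁻¹‖ * ‖Q - R‖) := by
          gcongr
          refine (Matrix.frobenius_norm_mul _ _).trans ?_
          gcongr; exact Matrix.frobenius_norm_mul _ _
      _ ≤ c * ((B * ‖H‖) * ‖R⁻¹‖ * (B * ‖H‖)) := by gcongr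
      _ = _ := by ring
  refine (abs_add_le _ _).trans ?_
  rw [add_mul]
  exact add_le_add t1 t2

theorem continuous_smoothedLoss {τ : ℝ} (hτ : 0 < τ) {S₀ : Matrix (Fin n) (Fin n) ℝ}
    (hS₀ : S₀.PosDef) :
    Continuous (smoothedLoss τ S₀ : Matrix (Fin n) (Fin m) ℝ → ℝ) :=
  continuous_iff_continuousAt.2 fun W => (hasFDerivAt_smoothedLoss hτ hS₀ W).continuousAt

theorem hasDerivAt_add_smul {E : Type*} [NormedAddCommGroup E] [NormedSpace ℝ E] (x v : E) :
    HasDerivAt (fun t : ℝ => x + t • v) v 0 := by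
  simpa using ((hasDerivAt_id (0 : ℝ)).smul_const v).const_add x

theorem hasDerivAt_smoothedLoss_line {τ : ℝ} (hτ : 0 < τ) {S₀ : Matrix (Fin n) (Fin n) ℝ}
    (hS₀ : S₀.PosDef) (W H : Matrix (Fin n) (Fin m) ℝ) :
    HasDerivAt (fun t : ℝ => smoothedLoss τ S₀ (W + t • H))
      (2 * (Wᵀ * (1 - transportMap τ S₀ W) * H).trace) 0 := by
  have h := hasFDerivAt_smoothedLoss hτ hS₀ W
  have h' : HasFDerivAt (smoothedLoss τ S₀) (lossDeriv τ S₀ W) (W + (0 : ℝ) • H) := by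
    simpa using h
  exact h'.comp_hasDerivAt (0 : ℝ) (hasDerivAt_add_smul W H)

/-- If the derivative vanishes along all directions `Y W`, then `W` is fixed by the transport
map. -/
theorem transportMap_mul_eq_of_trace_eq_zero {τ : ℝ} {S₀ : Matrix (Fin n) (Fin n) ℝ}
    {W : Matrix (Fin n) (Fin m) ℝ}
    (h : ∀ Y : Matrix (Fin n) (Fin n) ℝ,
      2 * (Wᵀ * (1 - transportMap τ S₀ W) * (Y * W)).trace = 0) :
    transportMap τ S₀ W * W = W := by
  have hGt := transportMap_transpose τ S₀ W
  set G := transportMap τ S₀ W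
  have h1 : W * Wᵀ * (1 - G) = 0 := by
    refine Matrix.ext_iff_trace_mul_right.2 fun Y => ?_
    rw [Matrix.zero_mul, Matrix.trace_zero, ← (mul_eq_zero.1 (h Y)).resolve_left two_ne_zero,
      ← Matrix.mul_assoc _ Y, Matrix.trace_mul_comm _ W]
    simp only [Matrix.mul_assoc]
  have h2 : Wᵀ * (1 - G) = 0 := by
    simpa [Matrix.conjTranspose_eq_transpose_of_trivial] using
      (Matrix.self_mul_conjTranspose_mul_eq_zero W (1 - G)).1
        (by rwa [Matrix.conjTranspose_eq_transpose_of_trivial])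
  have h3 := congrArg Matrix.transpose h2
  rw [Matrix.transpose_mul, Matrix.transpose_sub, hGt, Matrix.transpose_one,
    Matrix.transpose_transpose, Matrix.transpose_zero, Matrix.sub_mul, Matrix.one_mul,
    sub_eq_zero] at h3
  exact h3.symm

/-- As a left multiple of `W`, the perturbed matrix never has larger rank, and it has equal rank
while `1 + t • Y` is invertible. -/
theorem one_add_smul_mul (W : Matrix (Fin n) (Fin m) ℝ) (Y : Matrix (Fin n) (Fin n) ℝ) (t : ℝ) :
    W + t • (Y * W) = (1 + t • Y) * W := by
  rw [Matrix.add_mul, Matrix.one_mul, Matrix.smul_mul]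

theorem exists_rank_line_eq (W : Matrix (Fin n) (Fin m) ℝ) (Y : Matrix (Fin n) (Fin n) ℝ) :
    ∃ ε : ℝ, 0 < ε ∧ ∀ t ∈ Set.Ioo (-ε) ε, (W + t • (Y * W)).rank = W.rank := by
  have hc : Continuous fun t : ℝ => (1 + t • Y).det := by fun_prop
  have h0 : ∀ᶠ t in nhds (0 : ℝ), (1 + t • Y).det ≠ 0 :=
    hc.continuousAt.eventually_ne (by simp)
  obtain ⟨ε, hε, hball⟩ := Metric.eventually_nhds_iff_ball.1 h0
  refine ⟨ε, hε, fun t ht => ?_⟩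
  rw [one_add_smul_mul]
  refine Matrix.rank_mul_eq_right_of_isUnit_det _ _ (isUnit_iff_ne_zero.2 (hball t ?_))
  rw [Real.ball_eq_Ioo]
  simpa using ht

theorem isCriticalOnRank_iff {τ : ℝ} (hτ : 0 < τ) {S₀ : Matrix (Fin n) (Fin n) ℝ}
    (hS₀ : S₀.PosDef) {k : ℕ} {W : Matrix (Fin n) (Fin m) ℝ} (hW : W ∈ rankEq n m k) :
    IsCriticalOnRank (smoothedLoss τ S₀) k W ↔ transportMap τ S₀ W * W = W := by
  constructor
  · rintro ⟨-, f', hf', hzero⟩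
    refine transportMap_mul_eq_of_trace_eq_zero fun Y => ?_
    obtain ⟨ε, hε, hrank⟩ := exists_rank_line_eq W Y
    have hmem : ∀ t ∈ Set.Ioo (-ε) ε, W + t • (Y * W) ∈ rankEq n m k := fun t ht =>
      (hrank t ht).trans hW
    have hv := hzero (Y * W) ⟨fun t => W + t • (Y * W), ε, hε, by fun_prop, hmem, by simp,
      hasDerivAt_add_smul W (Y * W)⟩
    -- `f'` need not be `lossDeriv`, as it is a derivative only within the manifold. Both compute
    -- the derivative of the loss along the same line, so they agree on `Y * W`.
    have hf'' : HasFDerivWithinAt (smoothedLoss τ S₀) f' (rankEq n m k)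
      (W + (0 : ℝ) • (Y * W)) := by simpa using hf'
    have hd := hf''.comp_hasDerivWithinAt (0 : ℝ)
      (hasDerivAt_add_smul W (Y * W)).hasDerivWithinAt (s := Set.Ioo (-ε) ε) hmem
    have hd' := hd.hasDerivAt (Ioo_mem_nhds (neg_lt_zero.2 hε) hε)
    exact ((hasDerivAt_smoothedLoss_line hτ hS₀ W (Y * W)).unique hd').trans hv
  · intro h
    refine ⟨hW, lossDeriv τ S₀ W, (hasFDerivAt_smoothedLoss hτ hS₀ W).hasFDerivWithinAt,
      fun H _ => ?_⟩
    have h1 : Wᵀ * (1 - transportMap τ S₀ W) = 0 := by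
      have h2 := congrArg Matrix.transpose h
      rw [Matrix.transpose_mul, transportMap_transpose] at h2
      rw [Matrix.mul_sub, Matrix.mul_one, h2, sub_self]
    exact (lossDeriv_apply τ S₀ W H).trans (by simp [h1])

theorem transportMap_mul_eq_of_isMinOn {τ : ℝ} (hτ : 0 < τ) {S₀ : Matrix (Fin n) (Fin n) ℝ}
    (hS₀ : S₀.PosDef) {k : ℕ} {W : Matrix (Fin n) (Fin m) ℝ} (hW : W ∈ rankLE n m k)
    (hmin : IsMinOn (smoothedLoss τ S₀) (rankLE n m k) W) : transportMap τ S₀ W * W = W := by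
  refine transportMap_mul_eq_of_trace_eq_zero fun Y => ?_
  refine IsLocalMin.hasDerivAt_eq_zero (Filter.Eventually.of_forall fun t => ?_)
    (hasDerivAt_smoothedLoss_line hτ hS₀ W (Y * W))
  have ht : W + t • (Y * W) ∈ rankLE n m k := by
    rw [one_add_smul_mul]
    exact (Matrix.rank_mul_le_right _ _).trans hW
  simpa using hmin ht

end Derivative

/-! ### Diagonalization in the eigenbasis of the target -/

section Spectral

variable {n m : ℕ} {Ω : Matrix (Fin n) (Fin n) ℝ}

theorem diagonalize_mul (hΩ : Ωᵀ * Ω = 1) (a b : Fin n → ℝ) :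
    Ω * Matrix.diagonal a * Ωᵀ * (Ω * Matrix.diagonal b * Ωᵀ) =
      Ω * Matrix.diagonal (a * b) * Ωᵀ := by
  calc _ = Ω * Matrix.diagonal a * (Ωᵀ * Ω) * Matrix.diagonal b * Ωᵀ := by
        simp only [Matrix.mul_assoc]
    _ = Ω * (Matrix.diagonal a * Matrix.diagonal b) * Ωᵀ := by
        rw [hΩ, Matrix.mul_one, Matrix.mul_assoc Ω]
    _ = _ := by rw [Matrix.diagonal_mul_diagonal]; rfl

theorem diagonalize_trace (hΩ : Ωᵀ * Ω = 1) (a : Fin n → ℝ) :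
    (Ω * Matrix.diagonal a * Ωᵀ).trace = ∑ i, a i := by
  rw [Matrix.trace_mul_comm, ← Matrix.mul_assoc, hΩ, Matrix.one_mul, Matrix.trace_diagonal]

theorem diagonalize_posSemidef {a : Fin n → ℝ} (ha : ∀ i, 0 ≤ a i) :
    (Ω * Matrix.diagonal a * Ωᵀ).PosSemidef := by
  have := (Matrix.PosSemidef.diagonal (d := a) ha).mul_mul_conjTranspose_same Ω
  rwa [Matrix.conjTranspose_eq_transpose_of_trivial] at this

theorem diagonalize_posDef (hΩ : Ωᵀ * Ω = 1) {a : Fin n → ℝ} (ha : ∀ i, 0 < a i) :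
    (Ω * Matrix.diagonal a * Ωᵀ).PosDef := by
  have hu : IsUnit Ω := (Matrix.isUnit_iff_isUnit_det _).2 (Matrix.isUnit_det_of_left_inverse hΩ)
  have := (Matrix.IsUnit.posDef_star_right_conjugate_iff hu).2 (Matrix.PosDef.diagonal (d := a) ha)
  rwa [Matrix.star_eq_conjTranspose, Matrix.conjTranspose_eq_transpose_of_trivial] at this

theorem psdSqrt_diagonalize (hΩ : Ωᵀ * Ω = 1) {a : Fin n → ℝ} (ha : ∀ i, 0 ≤ a i) :
    psdSqrt (Ω * Matrix.diagonal a * Ωᵀ) = Ω * Matrix.diagonal (fun i => √(a i)) * Ωᵀ := by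
  refine psdSqrt_eq_of_mul_self (diagonalize_posSemidef fun i => Real.sqrt_nonneg _) ?_
  rw [diagonalize_mul hΩ]
  congr 3
  funext i
  exact Real.mul_self_sqrt (ha i)

theorem psdSqrt_diagonal {a : Fin n → ℝ} (ha : ∀ i, 0 ≤ a i) :
    psdSqrt (Matrix.diagonal a) = Matrix.diagonal fun i => √(a i) := by
  simpa using psdSqrt_diagonalize (Ω := 1) (by simp) ha

variable {lam d : Fin n → ℝ} {τ : ℝ} {W : Matrix (Fin n) (Fin m) ℝ}

theorem cov_diagonalize (hΩ' : Ω * Ωᵀ = 1) (hd : W * Wᵀ = Ω * Matrix.diagonal d * Ωᵀ) :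
    W * Wᵀ + τ • (1 : Matrix (Fin n) (Fin n) ℝ) =
      Ω * Matrix.diagonal (fun i => d i + τ) * Ωᵀ := by
  have h : Matrix.diagonal (fun i => d i + τ) =
      Matrix.diagonal d + τ • (1 : Matrix (Fin n) (Fin n) ℝ) := by
    rw [Matrix.smul_one_eq_diagonal, Matrix.diagonal_add]
  rw [h, hd, Matrix.mul_add, Matrix.add_mul, Matrix.mul_smul, Matrix.mul_one, Matrix.smul_mul, hΩ']

theorem psdSqrt_conjCov_diagonalize (hΩ : Ωᵀ * Ω = 1) (hΩ' : Ω * Ωᵀ = 1) (hlam : ∀ i, 0 < lam i)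
    (hτ : 0 < τ) (hd0 : ∀ i, 0 ≤ d i) (hd : W * Wᵀ = Ω * Matrix.diagonal d * Ωᵀ) :
    psdSqrt (conjCov τ (Ω * Matrix.diagonal lam * Ωᵀ) W) =
      Ω * Matrix.diagonal (fun i => √(lam i) * √(d i + τ)) * Ωᵀ := by
  rw [conjCov, cov_diagonalize hΩ' hd, psdSqrt_diagonalize hΩ fun i => (hlam i).le,
    diagonalize_mul hΩ, diagonalize_mul hΩ, psdSqrt_diagonalize hΩ]
  · congr 3
    funext i
    have h : √(lam i) * (d i + τ) * √(lam i) = lam i * (d i + τ) := by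
      rw [mul_right_comm, Real.mul_self_sqrt (hlam i).le]
    simp only [Pi.mul_apply, h]
    exact Real.sqrt_mul (hlam i).le _
  · intro i
    have := hd0 i
    simp only [Pi.mul_apply]
    positivity

theorem smoothedLoss_diagonalize (hΩ : Ωᵀ * Ω = 1) (hΩ' : Ω * Ωᵀ = 1) (hlam : ∀ i, 0 < lam i)
    (hτ : 0 < τ) (hd0 : ∀ i, 0 ≤ d i) (hd : W * Wᵀ = Ω * Matrix.diagonal d * Ωᵀ) :
    smoothedLoss τ (Ω * Matrix.diagonal lam * Ωᵀ) W = ∑ i, (√(lam i) - √(d i + τ)) ^ 2 := by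
  have hn : τ * (n : ℝ) = ∑ _i : Fin n, τ := by simp [mul_comm]
  rw [smoothedLoss_eq, psdSqrt_conjCov_diagonalize hΩ hΩ' hlam hτ hd0 hd, hd,
    diagonalize_trace hΩ, diagonalize_trace hΩ, diagonalize_trace hΩ, hn, Finset.mul_sum,
    ← Finset.sum_add_distrib, ← Finset.sum_add_distrib, ← Finset.sum_sub_distrib]
  refine Finset.sum_congr rfl fun i _ => ?_
  rw [sub_sq, Real.sq_sqrt (hlam i).le, Real.sq_sqrt (by linarith [hd0 i])]
  ring

theorem rank_of_diagonalize (hΩ : Ωᵀ * Ω = 1) (hd : W * Wᵀ = Ω * Matrix.diagonal d * Ωᵀ) :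
    W.rank = (Finset.univ.filter fun i => d i ≠ 0).card := by
  have hu : IsUnit Ω.det := Matrix.isUnit_det_of_left_inverse hΩ
  rw [← Matrix.rank_self_mul_transpose, hd, Matrix.rank_mul_eq_left_of_isUnit_det,
    Matrix.rank_mul_eq_right_of_isUnit_det _ _ hu, Matrix.rank_diagonal, Fintype.card_subtype]
  rwa [Matrix.det_transpose]

/-- `G` has eigenvalues `√λ_i / √(d_i + τ)`, equal to `1` wherever `d_i = λ_i - τ`. Hence `G - 1`
annihilates `W Wᵀ`, and therefore `W`. -/
theorem transportMap_mul_eq_of_diagonalize (hΩ : Ωᵀ * Ω = 1) (hΩ' : Ω * Ωᵀ = 1)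
    (hlam : ∀ i, 0 < lam i) (hτ : 0 < τ) (hd0 : ∀ i, 0 ≤ d i)
    (hd : W * Wᵀ = Ω * Matrix.diagonal d * Ωᵀ) (h : ∀ i, d i = 0 ∨ d i = lam i - τ) :
    transportMap τ (Ω * Matrix.diagonal lam * Ωᵀ) W * W = W := by
  have hinv : (psdSqrt (conjCov τ (Ω * Matrix.diagonal lam * Ωᵀ) W))⁻¹ =
      Ω * Matrix.diagonal (fun i => (√(lam i) * √(d i + τ))⁻¹) * Ωᵀ := by
    refine Matrix.inv_eq_left_inv ?_
    rw [psdSqrt_conjCov_diagonalize hΩ hΩ' hlam hτ hd0 hd, diagonalize_mul hΩ]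
    have h1 : ((fun i => (√(lam i) * √(d i + τ))⁻¹) * fun i => √(lam i) * √(d i + τ)) = 1 := by
      funext i
      have h2 := Real.sqrt_pos.2 (hlam i)
      have h3 := Real.sqrt_pos.2 (by linarith [hd0 i] : 0 < d i + τ)
      exact inv_mul_cancel₀ (by positivity)
    rw [h1, Matrix.diagonal_one', Matrix.mul_one, hΩ']
  have hGW : (transportMap τ (Ω * Matrix.diagonal lam * Ωᵀ) W - 1) * (W * Wᵀ) = 0 := by
    rw [Matrix.sub_mul, Matrix.one_mul, sub_eq_zero, transportMap, hinv, hd,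
      psdSqrt_diagonalize hΩ fun i => (hlam i).le, diagonalize_mul hΩ, diagonalize_mul hΩ,
      diagonalize_mul hΩ]
    congr 3
    funext i
    simp only [Pi.mul_apply]
    rcases h i with h0 | h0
    · rw [h0, mul_zero]
    · have h2 := Real.sqrt_pos.2 (hlam i)
      have h3 : d i + τ = lam i := by rw [h0]; ring
      rw [h3]
      field_simp
  have h1 := (Matrix.mul_self_mul_conjTranspose_eq_zero W
    (transportMap τ (Ω * Matrix.diagonal lam * Ωᵀ) W - 1)).1
    (by rwa [Matrix.conjTranspose_eq_transpose_of_trivial])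
  rwa [Matrix.sub_mul, Matrix.one_mul, sub_eq_zero] at h1

theorem mul_cov_eq_of_transportMap_mul_eq (hτ : 0 < τ) {S₀ : Matrix (Fin n) (Fin n) ℝ}
    (hS₀ : S₀.PosDef) (h : transportMap τ S₀ W * W = W) :
    S₀ * (W * Wᵀ) = W * Wᵀ * (W * Wᵀ) + τ • (W * Wᵀ) := by
  have h2 := transportMap_mul_cov_mul hτ hS₀ W
  set G := transportMap τ S₀ W
  calc S₀ * (W * Wᵀ) = G * (W * Wᵀ + τ • (1 : Matrix (Fin n) (Fin n) ℝ)) * (G * W) * Wᵀ := by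
        rw [← h2]; simp only [Matrix.mul_assoc]
    _ = G * W * (Wᵀ * (W * Wᵀ)) + τ • (G * W * Wᵀ) := by
        conv_lhs => rw [h, Matrix.mul_add, Matrix.add_mul, Matrix.add_mul, Matrix.mul_smul,
          Matrix.mul_one, Matrix.smul_mul, Matrix.smul_mul]
        simp only [Matrix.mul_assoc]
    _ = _ := by rw [h, Matrix.mul_assoc W]

/-- The covariance of a point fixed by the transport map is diagonal in the eigenbasis of the
target, with eigenvalues `0` or `λ_i - τ`. -/
theorem exists_diagonalize_of_transportMap_mul_eq (hΩ : Ωᵀ * Ω = 1) (hΩ' : Ω * Ωᵀ = 1)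
    (hlam : ∀ i, 0 < lam i) (hinj : Function.Injective lam) (hτ : 0 < τ)
    (h : transportMap τ (Ω * Matrix.diagonal lam * Ωᵀ) W * W = W) :
    ∃ d : Fin n → ℝ, (∀ i, 0 ≤ d i) ∧ W * Wᵀ = Ω * Matrix.diagonal d * Ωᵀ ∧
      ∀ i, d i = 0 ∨ d i = lam i - τ := by
  have hS := mul_cov_eq_of_transportMap_mul_eq hτ (diagonalize_posDef hΩ hlam) h
  set P := Ωᵀ * (W * Wᵀ) * Ω with hP
  have hPW : W * Wᵀ = Ω * P * Ωᵀ := by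
    calc W * Wᵀ = Ω * Ωᵀ * (W * Wᵀ) * (Ω * Ωᵀ) := by rw [hΩ', Matrix.one_mul, Matrix.mul_one]
      _ = _ := by rw [hP]; simp only [Matrix.mul_assoc]
  have hPt : Pᵀ = P := by
    simp only [hP, Matrix.transpose_mul, Matrix.transpose_transpose, Matrix.mul_assoc]
  have hlP : Matrix.diagonal lam * P = P * P + τ • P := by
    calc Matrix.diagonal lam * P
        = Ωᵀ * Ω * Matrix.diagonal lam * Ωᵀ * (W * Wᵀ) * Ω := by
          rw [hΩ, Matrix.one_mul, hP]; simp only [Matrix.mul_assoc]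
      _ = Ωᵀ * (Ω * Matrix.diagonal lam * Ωᵀ * (W * Wᵀ)) * Ω := by simp only [Matrix.mul_assoc]
      _ = Ωᵀ * (W * Wᵀ) * (Ω * Ωᵀ) * (W * Wᵀ) * Ω + τ • P := by
          rw [hS, hΩ', Matrix.mul_one, Matrix.mul_add, Matrix.add_mul, Matrix.mul_smul,
            Matrix.smul_mul]
          simp only [Matrix.mul_assoc, hP]
      _ = P * P + τ • P := by rw [hP]; simp only [Matrix.mul_assoc]
  -- The transpose of `hlP`: `P` commutes with a diagonal matrix whose entries are distinct, hence
  -- is diagonal.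
  have hPl : P * Matrix.diagonal lam = P * P + τ • P := by
    have := congrArg Matrix.transpose hlP
    simpa [Matrix.transpose_mul, hPt] using this
  have hoff : P = Matrix.diagonal fun i => P i i := by
    ext i j
    rcases eq_or_ne i j with rfl | hij
    · simp
    · rw [Matrix.diagonal_apply_ne _ hij]
      have h1 := congrFun (congrFun (hlP.trans hPl.symm) i) j
      rw [Matrix.diagonal_mul, Matrix.mul_diagonal] at h1
      have h2 : (lam i - lam j) * P i j = 0 := by linarith
      exact (mul_eq_zero.1 h2).resolve_left (sub_ne_zero.2 (hinj.ne hij))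
  refine ⟨fun i => P i i, fun i => ?_, ?_, fun i => ?_⟩
  · have hps : P = (Ωᵀ * W) * (Ωᵀ * W)ᵀ := by
      rw [hP]
      simp only [Matrix.transpose_mul, Matrix.transpose_transpose, Matrix.mul_assoc]
    change 0 ≤ P i i
    rw [hps, Matrix.mul_apply]
    exact Finset.sum_nonneg fun a _ => by
      rw [Matrix.transpose_apply]; exact mul_self_nonneg _
  · rw [← hoff, hPW]
  · have h1 := congrFun (congrFun hlP i) i
    have h2 : (P * P) i i = P i i * P i i := by
      conv_lhs => rw [hoff, Matrix.diagonal_mul_diagonal, Matrix.diagonal_apply_eq]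
    rw [Matrix.diagonal_mul, Matrix.add_apply, h2, Matrix.smul_apply, smul_eq_mul] at h1
    have h3 : P i i * (P i i - (lam i - τ)) = 0 := by linarith
    rcases mul_eq_zero.1 h3 with h4 | h4
    · exact Or.inl h4
    · exact Or.inr (sub_eq_zero.1 h4)

end Spectral

/-! ### Candidate points and their covariances -/

section Candidate

variable {n m k : ℕ} {Ω : Matrix (Fin n) (Fin n) ℝ} {lam : Fin n → ℝ} {τ : ℝ}

/-- The eigenvalues of `W Wᵀ` at a candidate point. -/
def excess (τ : ℝ) (lam : Fin n → ℝ) (J : Finset (Fin n)) (i : Fin n) : ℝ :=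
  if i ∈ J then lam i - τ else 0

theorem excess_nonneg {J : Finset (Fin n)} (h : ∀ j ∈ J, τ ≤ lam j) (i : Fin n) :
    0 ≤ excess τ lam J i := by
  unfold excess
  split_ifs with hi
  · exact sub_nonneg.2 (h i hi)
  · exact le_rfl

theorem sum_orderEmbOfFin (J : Finset (Fin n)) (hJ : J.card = k) (g : Fin n → ℝ) :
    ∑ j, g (J.orderEmbOfFin hJ j) = ∑ j ∈ J, g j := by
  conv_rhs => rw [← Finset.map_orderEmbOfFin_univ J hJ, Finset.sum_map]
  rfl

theorem candidate_apply {J : Finset (Fin n)} (hJ : J.card = k) (h : ∀ j ∈ J, τ ≤ lam j)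
    (V : Matrix (Fin m) (Fin k) ℝ) (x : Fin n) (a : Fin m) :
    candidate τ Ω (Matrix.diagonal lam) J hJ V x a =
      ∑ j, Ω x (J.orderEmbOfFin hJ j) * √(lam (J.orderEmbOfFin hJ j) - τ) * V a j := by
  have h1 : principalSub (Matrix.diagonal lam) J hJ - τ • (1 : Matrix (Fin k) (Fin k) ℝ) =
      Matrix.diagonal fun j => lam (J.orderEmbOfFin hJ j) - τ := by
    rw [principalSub, Matrix.submatrix_diagonal _ _ (J.orderEmbOfFin hJ).injective,
      Matrix.smul_one_eq_diagonal, Matrix.diagonal_sub]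
    rfl
  rw [candidate, h1, psdSqrt_diagonal fun j => sub_nonneg.2 (h _ (J.orderEmbOfFin_mem hJ j)),
    Matrix.mul_apply]
  refine Finset.sum_congr rfl fun j _ => ?_
  rw [Matrix.mul_diagonal]
  rfl

theorem candidate_mul_transpose {J : Finset (Fin n)} (hJ : J.card = k) (h : ∀ j ∈ J, τ ≤ lam j)
    {V : Matrix (Fin m) (Fin k) ℝ} (hV : Vᵀ * V = 1) :
    candidate τ Ω (Matrix.diagonal lam) J hJ V * (candidate τ Ω (Matrix.diagonal lam) J hJ V)ᵀ =
      Ω * Matrix.diagonal (excess τ lam J) * Ωᵀ := by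
  set B : Matrix (Fin n) (Fin k) ℝ := Matrix.of fun x j =>
    Ω x (J.orderEmbOfFin hJ j) * √(lam (J.orderEmbOfFin hJ j) - τ) with hB
  have hc : candidate τ Ω (Matrix.diagonal lam) J hJ V = B * Vᵀ := by
    ext x a
    rw [candidate_apply hJ h, Matrix.mul_apply]
    rfl
  rw [hc, Matrix.transpose_mul, Matrix.transpose_transpose, Matrix.mul_assoc,
    ← Matrix.mul_assoc Vᵀ, hV, Matrix.one_mul]
  ext x y
  rw [Matrix.mul_apply, Matrix.mul_apply]
  simp only [Matrix.mul_diagonal, Matrix.transpose_apply, hB, Matrix.of_apply]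
  rw [sum_orderEmbOfFin J hJ fun j => Ω x j * √(lam j - τ) * (Ω y j * √(lam j - τ))]
  rw [← Finset.sum_subset (Finset.subset_univ J)]
  · refine Finset.sum_congr rfl fun j hj => ?_
    rw [excess, if_pos hj]
    linear_combination (Ω x j * Ω y j) * Real.mul_self_sqrt (sub_nonneg.2 (h j hj))
  · intro j _ hj
    rw [excess, if_neg hj, mul_zero, zero_mul]

/-- A matrix whose covariance is that of a candidate point is a candidate point. -/
theorem exists_eq_candidate (hΩ : Ωᵀ * Ω = 1) (hΩ' : Ω * Ωᵀ = 1) (hkm : k ≤ m)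
    {J : Finset (Fin n)} (hJ : J.card = k) (h : ∀ j ∈ J, τ ≤ lam j)
    {W : Matrix (Fin n) (Fin m) ℝ} (hW : W * Wᵀ = Ω * Matrix.diagonal (excess τ lam J) * Ωᵀ) :
    ∃ V : Matrix (Fin m) (Fin k) ℝ, Vᵀ * V = 1 ∧
      W = candidate τ Ω (Matrix.diagonal lam) J hJ V := by
  set U := Ωᵀ * W with hU
  have hUU : U * Uᵀ = Matrix.diagonal (excess τ lam J) := by
    calc U * Uᵀ = Ωᵀ * (W * Wᵀ) * Ω := by
          rw [hU]; simp only [Matrix.transpose_mul, Matrix.transpose_transpose, Matrix.mul_assoc]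
      _ = Ωᵀ * Ω * Matrix.diagonal (excess τ lam J) * (Ωᵀ * Ω) := by
          rw [hW]; simp only [Matrix.mul_assoc]
      _ = _ := by rw [hΩ, Matrix.one_mul, Matrix.mul_one]
  have hrow : ∀ i j, ∑ a, U i a * U j a = Matrix.diagonal (excess τ lam J) i j := by
    intro i j
    rw [← hUU, Matrix.mul_apply]
    rfl
  have hrow0 : ∀ i, excess τ lam J i = 0 → ∀ a, U i a = 0 := by
    intro i hi a
    have h1 := hrow i i
    rw [Matrix.diagonal_apply_eq, hi,
      Finset.sum_eq_zero_iff_of_nonneg fun a _ => mul_self_nonneg _] at h1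
    exact mul_self_eq_zero.1 (h1 a (Finset.mem_univ a))
  set e := J.orderEmbOfFin hJ with he
  have hex : ∀ j, excess τ lam J (e j) = lam (e j) - τ := fun j => if_pos (J.orderEmbOfFin_mem hJ j)
  -- The normalized rows of `Ωᵀ W` are the forced columns of `V`, but only on `s`, where `λ > τ`.
  -- Where `λ = τ` the row vanishes and so does the factor `√(λ - τ)`, so any orthonormal completion
  -- serves. The value `0` for `i ≥ k` is never used.
  let v : Fin m → EuclideanSpace ℝ (Fin m) := fun i =>
    if hi : (i : ℕ) < k then WithLp.toLp 2 fun a => (√(lam (e ⟨i, hi⟩) - τ))⁻¹ * U (e ⟨i, hi⟩) a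
    else 0
  let s : Set (Fin m) := {i | ∃ hi : (i : ℕ) < k, τ < lam (e ⟨i, hi⟩)}
  have hv : Orthonormal ℝ (s.domRestrict v) := by
    rw [orthonormal_iff_ite]
    rintro ⟨i, hi, hi'⟩ ⟨j, hj, hj'⟩
    have hinner : inner ℝ (v i) (v j) = (√(lam (e ⟨i, hi⟩) - τ))⁻¹ * (√(lam (e ⟨j, hj⟩) - τ))⁻¹ *
        Matrix.diagonal (excess τ lam J) (e ⟨i, hi⟩) (e ⟨j, hj⟩) := by
      rw [← hrow, Finset.mul_sum]
      simp only [v, dif_pos hi, dif_pos hj, PiLp.inner_apply, RCLike.inner_apply, conj_trivial]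
      exact Finset.sum_congr rfl fun a _ => by ring
    change inner ℝ (v i) (v j) = _
    rw [hinner]
    by_cases hij : i = j
    · subst hij
      have h1 := Real.sqrt_pos.2 (sub_pos.2 hi')
      rw [if_pos rfl, Matrix.diagonal_apply_eq, hex]
      nth_rewrite 3 [← Real.mul_self_sqrt (sub_pos.2 hi').le]
      field_simp
    · rw [if_neg (fun h => hij (congrArg Subtype.val h)), Matrix.diagonal_apply_ne, mul_zero]
      intro h1
      exact hij (Fin.ext (Fin.mk.inj_iff.1 (e.injective h1)))
  obtain ⟨b, hb⟩ := hv.exists_orthonormalBasis_extension_of_card_eq (by simp)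
  refine ⟨Matrix.of fun a j => b (Fin.castLE hkm j) a, ?_, ?_⟩
  · ext i j
    have h1 := orthonormal_iff_ite.1 b.orthonormal (Fin.castLE hkm i) (Fin.castLE hkm j)
    rw [PiLp.inner_apply] at h1
    simp only [RCLike.inner_apply, conj_trivial, (Fin.castLE_injective hkm).eq_iff] at h1
    rw [Matrix.one_apply, ← h1, Matrix.mul_apply]
    exact Finset.sum_congr rfl fun a _ => mul_comm _ _
  · ext x a
    have h1 : W x a = ∑ i, Ω x i * U i a := by
      rw [← Matrix.mul_apply, hU, ← Matrix.mul_assoc, hΩ', Matrix.one_mul]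
    rw [candidate_apply hJ h, h1, ← Finset.sum_subset (Finset.subset_univ J),
      ← sum_orderEmbOfFin J hJ fun j => Ω x j * U j a]
    · refine Finset.sum_congr rfl fun j _ => ?_
      rw [mul_assoc]
      congr 1
      rcases (h _ (J.orderEmbOfFin_mem hJ j)).eq_or_lt with h2 | h2
      · rw [← h2, sub_self, Real.sqrt_zero, zero_mul]
        exact hrow0 _ (by rw [← he, hex, he, ← h2, sub_self]) a
      · have h3 : Fin.castLE hkm j ∈ s := ⟨j.2, h2⟩
        have h4 := Real.sqrt_pos.2 (sub_pos.2 h2)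
        rw [Matrix.of_apply, hb _ h3]
        have h5 : ((Fin.castLE hkm j : Fin m) : ℕ) < k := j.2
        simp only [v, dif_pos h5]
        exact (mul_inv_cancel_left₀ h4.ne' _).symm
    · intro i _ hi
      rw [hrow0 i (if_neg hi), mul_zero]

end Candidate

/-! ### Existence of a minimizer -/

section Minimum

open scoped Matrix.Norms.Frobenius

variable {n m : ℕ}

theorem isClosed_rankLE (n m k : ℕ) : IsClosed (rankLE n m k) := by
  let φ : Matrix (Fin n) (Fin m) ℝ →ₗ[ℝ] ((Fin m → ℝ) →L[ℝ] (Fin n → ℝ)) :=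
    (LinearMap.toContinuousLinearMap (𝕜 := ℝ) (E := Fin m → ℝ) (F' := Fin n → ℝ)).toLinearMap ∘ₗ
      (Matrix.toLin' (R := ℝ) (m := Fin n) (n := Fin m)).toLinearMap
  have hφ : Continuous φ := LinearMap.continuous_of_finiteDimensional φ
  -- Lower semicontinuity of the rank: the complement is the set of rank at least `k + 1`.
  have ho := (isOpen_setOfPred_nat_le_rank (𝕜 := ℝ) (E := Fin m → ℝ) (F := Fin n → ℝ)
    (k + 1)).preimage hφ
  rw [← isOpen_compl_iff]
  convert ho using 1
  ext W
  have h1 : LinearMap.rank ((φ W : (Fin m → ℝ) →L[ℝ] (Fin n → ℝ)) :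
      (Fin m → ℝ) →ₗ[ℝ] (Fin n → ℝ)) = (W.rank : Cardinal) := by
    rw [Matrix.rank, Module.finrank_eq_rank]
    rfl
  change ¬ (W.rank ≤ k) ↔ ((k + 1 : ℕ) : Cardinal) ≤ LinearMap.rank _
  rw [h1, Nat.cast_le, not_le, Nat.succ_le_iff]

/-- Expand `0 ≤ ‖c √S - 1‖²` and divide by `c`. The free `c` lets the negative term of the loss be
absorbed by `‖W‖²`. -/
theorem two_mul_trace_psdSqrt_le {S : Matrix (Fin n) (Fin n) ℝ} (hS : S.PosSemidef) {c : ℝ}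
    (hc : 0 < c) : 2 * (psdSqrt S).trace ≤ c * S.trace + c⁻¹ * n := by
  have h := frobenius_norm_sq (c • psdSqrt S - 1)
  have h1 : (c • psdSqrt S - 1) * (c • psdSqrt S - 1)ᵀ =
      (c * c) • S - (2 * c) • psdSqrt S + 1 := by
    rw [Matrix.transpose_sub, Matrix.transpose_smul, psdSqrt_transpose, Matrix.transpose_one]
    nth_rewrite 3 [← psdSqrt_mul_self hS]
    simp only [Matrix.sub_mul, Matrix.mul_sub, Matrix.smul_mul, Matrix.mul_smul, Matrix.mul_one,
      Matrix.one_mul]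
    module
  rw [h1, Matrix.trace_add, Matrix.trace_sub, Matrix.trace_smul, Matrix.trace_smul,
    Matrix.trace_one, Fintype.card_fin, smul_eq_mul, smul_eq_mul] at h
  have h2 := sq_nonneg ‖c • psdSqrt S - 1‖
  rw [h] at h2
  have h3 : c * (c * S.trace + c⁻¹ * n - 2 * (psdSqrt S).trace) =
      c * c * S.trace - 2 * c * (psdSqrt S).trace + n := by
    field_simp
    ring
  rw [← h3] at h2
  linarith [nonneg_of_mul_nonneg_right h2 hc]

theorem trace_conjCov (τ : ℝ) (S₀ : Matrix (Fin n) (Fin n) ℝ) (W : Matrix (Fin n) (Fin m) ℝ) :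
    (conjCov τ S₀ W).trace = ‖psdSqrt S₀ * W‖ ^ 2 + τ * ‖psdSqrt S₀‖ ^ 2 := by
  rw [frobenius_norm_sq, frobenius_norm_sq, conjCov, Matrix.transpose_mul, psdSqrt_transpose,
    Matrix.mul_add, Matrix.add_mul, Matrix.mul_smul, Matrix.mul_one, Matrix.smul_mul,
    Matrix.trace_add, Matrix.trace_smul, smul_eq_mul]
  simp only [Matrix.mul_assoc]

theorem exists_le_smoothedLoss {τ : ℝ} (hτ : 0 < τ) {S₀ : Matrix (Fin n) (Fin n) ℝ}
    (hS₀ : S₀.PosDef) :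
    ∃ C : ℝ, ∀ W : Matrix (Fin n) (Fin m) ℝ, ‖W‖ ^ 2 / 2 - C ≤ smoothedLoss τ S₀ W := by
  set a := ‖psdSqrt S₀‖ with ha
  -- Chosen so that `c * a ^ 2 ≤ 1 / 2`, which leaves half of `‖W‖ ^ 2`; the `+ 1` keeps `c`
  -- positive when `a = 0`.
  set c : ℝ := (2 * (a ^ 2 + 1))⁻¹ with hc
  have hc0 : 0 < c := by positivity
  refine ⟨c * (τ * a ^ 2) + c⁻¹ * n - τ * n - S₀.trace, fun W => ?_⟩
  have h1 := two_mul_trace_psdSqrt_le (posDef_conjCov hτ hS₀ W).posSemidef hc0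
  rw [trace_conjCov, ← ha] at h1
  have h2 : ‖psdSqrt S₀ * W‖ ^ 2 ≤ a ^ 2 * ‖W‖ ^ 2 := by
    rw [← mul_pow]
    gcongr
    exact Matrix.frobenius_norm_mul _ _
  have h3 : c * a ^ 2 ≤ 1 / 2 := by
    rw [hc, inv_mul_le_iff₀ (by positivity)]
    linarith
  have h4 : c * ‖psdSqrt S₀ * W‖ ^ 2 ≤ ‖W‖ ^ 2 / 2 := by
    calc _ ≤ c * (a ^ 2 * ‖W‖ ^ 2) := by gcongr
      _ = c * a ^ 2 * ‖W‖ ^ 2 := by ring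
      _ ≤ 1 / 2 * ‖W‖ ^ 2 := by gcongr
      _ = _ := by ring
  rw [smoothedLoss_eq, ← frobenius_norm_sq]
  linarith

theorem exists_isMinOn_rankLE {τ : ℝ} (hτ : 0 < τ) {S₀ : Matrix (Fin n) (Fin n) ℝ}
    (hS₀ : S₀.PosDef) (m k : ℕ) :
    ∃ W ∈ rankLE n m k, IsMinOn (smoothedLoss τ S₀) (rankLE n m k) W := by
  obtain ⟨C, hC⟩ := exists_le_smoothedLoss (m := m) hτ hS₀
  have h0 : (0 : Matrix (Fin n) (Fin m) ℝ) ∈ rankLE n m k := by simp [rankLE]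
  refine (continuous_smoothedLoss hτ hS₀).continuousOn.exists_isMinOn' (isClosed_rankLE n m k) h0
    (Filter.Eventually.filter_mono inf_le_left ?_)
  have hlim : Filter.Tendsto (fun W : Matrix (Fin n) (Fin m) ℝ => ‖W‖ ^ 2 / 2 - C)
      (Filter.cocompact _) Filter.atTop := by
    refine Filter.tendsto_atTop_add_const_right _ (-C) ?_
    exact (Filter.Tendsto.comp (Filter.tendsto_pow_atTop two_ne_zero)
      (tendsto_norm_cocompact_atTop (E := Matrix (Fin n) (Fin m) ℝ))).atTop_div_const two_pos
  filter_upwards [hlim.eventually_ge_atTop (smoothedLoss τ S₀ 0)] with W hW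
  exact hW.trans (hC W)

end Minimum

/-! ### Comparison of index sets -/

section Comparison

variable {n k : ℕ} {lam : Fin n → ℝ} {τ : ℝ}

theorem mem_firstIndices {i : Fin n} : i ∈ firstIndices n k ↔ (i : ℕ) < k := by
  simp [firstIndices]

theorem gap_lt_gap (hτ : 0 < τ) {x y : ℝ} (h1 : τ ≤ y) (h2 : y < x) :
    (√y - √τ) ^ 2 < (√x - √τ) ^ 2 := by
  have h3 := Real.sqrt_le_sqrt h1
  have h4 := Real.sqrt_lt_sqrt (hτ.le.trans h1) h2
  exact pow_lt_pow_left₀ (by linarith) (by linarith) two_ne_zero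

/-- If leaving out `J` costs no more than leaving out the first `k` indices, then `J` consists of
the first `k` indices, up to indices with `λ_i = τ`. -/
theorem excess_eq_of_sum_le (hτ : 0 < τ) (hkn : k ≤ n) (hanti : StrictAnti lam)
    (hk : ∀ i : Fin n, (i : ℕ) < k → τ ≤ lam i) {J : Finset (Fin n)} (hJ : J.card ≤ k)
    (hJτ : ∀ j ∈ J, τ < lam j)
    (hle : ∑ j ∈ Jᶜ, (√(lam j) - √τ) ^ 2 ≤ ∑ j ∈ (firstIndices n k)ᶜ, (√(lam j) - √τ) ^ 2) :
    excess τ lam J = excess τ lam (firstIndices n k) := by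
  set K := firstIndices n k with hK
  set g : Fin n → ℝ := fun j => (√(lam j) - √τ) ^ 2 with hg
  have hg0 : ∀ j, 0 ≤ g j := fun j => sq_nonneg _
  have hle' : ∑ j ∈ K, g j ≤ ∑ j ∈ J, g j := by
    have h1 := Finset.sum_add_sum_compl J g
    have h2 := Finset.sum_add_sum_compl K g
    linarith
  have hle'' : ∑ j ∈ K \ J, g j ≤ ∑ j ∈ J \ K, g j := by
    have h1 := Finset.sum_inter_add_sum_sdiff K J g
    have h2 := Finset.sum_inter_add_sum_sdiff J K g
    rw [Finset.inter_comm] at h2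
    linarith
  have hcard : (J \ K).card ≤ (K \ J).card := by
    have h1 := Finset.card_inter_add_card_sdiff K J
    have h2 := Finset.card_inter_add_card_sdiff J K
    rw [Finset.inter_comm] at h2
    have h3 : K.card = k := card_firstIndices hkn
    omega
  have hJK : J \ K = ∅ := by
    by_contra hne
    -- Exchange argument: even the largest gap in `J \ K` is below every gap in `K \ J`, which has
    -- at least as many elements. This contradicts `hle''`.
    obtain ⟨j, hj, hjmax⟩ := Finset.exists_max_image (J \ K) g (Finset.nonempty_iff_ne_empty.2 hne)
    have hjJ := (Finset.mem_sdiff.1 hj).1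
    have hjk : k ≤ (j : ℕ) := by
      have := (Finset.mem_sdiff.1 hj).2
      rwa [hK, mem_firstIndices, not_lt] at this
    have hlt : ∀ i ∈ K \ J, g j < g i := by
      intro i hi
      have hik : (i : ℕ) < k := mem_firstIndices.1 (Finset.mem_sdiff.1 hi).1
      exact gap_lt_gap hτ (hJτ j hjJ).le (hanti (Fin.lt_def.2 (hik.trans_le hjk)))
    have hpos : 0 < (K \ J).card := (Finset.card_pos.2 ⟨j, hj⟩).trans_le hcard
    have h1 : ∑ i ∈ J \ K, g i ≤ (J \ K).card • g j := Finset.sum_le_card_nsmul _ _ _ hjmax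
    have h2 : (J \ K).card • g j ≤ (K \ J).card • g j := nsmul_le_nsmul_left (hg0 j) hcard
    have h3 : (K \ J).card • g j < ∑ i ∈ K \ J, g i := by
      rw [← Finset.sum_const]
      exact Finset.sum_lt_sum_of_nonempty (Finset.card_pos.1 hpos) hlt
    linarith
  rw [hJK, Finset.sum_empty] at hle''
  -- Indices in `K \ J` then have zero gap, so `λ_i = τ` and their excess vanishes anyway.
  have hzero := (Finset.sum_eq_zero_iff_of_nonneg fun i _ => hg0 i).1
    (le_antisymm hle'' (Finset.sum_nonneg fun i _ => hg0 i))
  funext i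
  by_cases hiJ : i ∈ J
  · have hiK : i ∈ K := Finset.sdiff_eq_empty_iff_subset.1 hJK hiJ
    rw [excess, excess, if_pos hiJ, if_pos hiK]
  · rw [excess, excess, if_neg hiJ]
    split_ifs with hiK
    · have h1 := sub_eq_zero.1 (pow_eq_zero_iff two_ne_zero |>.1
        (hzero i (Finset.mem_sdiff.2 ⟨hiK, hiJ⟩)))
      have h2 := hk i (mem_firstIndices.1 hiK)
      rw [(Real.sqrt_inj (hτ.le.trans h2) hτ.le).1 h1, sub_self]
    · rfl

end Comparison

/-! ### Critical values and minimizers -/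

section Loss

variable {n m k : ℕ} {Ω : Matrix (Fin n) (Fin n) ℝ} {lam : Fin n → ℝ} {τ : ℝ}

theorem smoothedLoss_of_excess (hΩ : Ωᵀ * Ω = 1) (hΩ' : Ω * Ωᵀ = 1) (hlam : ∀ i, 0 < lam i)
    (hτ : 0 < τ) {J : Finset (Fin n)} (hJ : ∀ j ∈ J, τ ≤ lam j) {W : Matrix (Fin n) (Fin m) ℝ}
    (hW : W * Wᵀ = Ω * Matrix.diagonal (excess τ lam J) * Ωᵀ) :
    smoothedLoss τ (Ω * Matrix.diagonal lam * Ωᵀ) W = ∑ j ∈ Jᶜ, (√(lam j) - √τ) ^ 2 := by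
  rw [smoothedLoss_diagonalize hΩ hΩ' hlam hτ (excess_nonneg hJ) hW,
    ← Finset.sum_subset (Finset.subset_univ Jᶜ)]
  · refine Finset.sum_congr rfl fun j hj => ?_
    rw [excess, if_neg (Finset.mem_compl.1 hj), zero_add]
  · intro j _ hj
    rw [Finset.mem_compl, not_not] at hj
    rw [excess, if_pos hj, sub_add_cancel, sub_self, zero_pow two_ne_zero]

/-- The covariance of a point fixed by the transport map, in terms of the index set of its
nonzero eigenvalues. -/
theorem exists_excess_of_transportMap_mul_eq (hΩ : Ωᵀ * Ω = 1) (hΩ' : Ω * Ωᵀ = 1)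
    (hlam : ∀ i, 0 < lam i) (hinj : Function.Injective lam) (hτ : 0 < τ)
    {W : Matrix (Fin n) (Fin m) ℝ}
    (h : transportMap τ (Ω * Matrix.diagonal lam * Ωᵀ) W * W = W) :
    ∃ J : Finset (Fin n), J.card = W.rank ∧ (∀ j ∈ J, τ < lam j) ∧
      W * Wᵀ = Ω * Matrix.diagonal (excess τ lam J) * Ωᵀ := by
  obtain ⟨d, hd0, hd, hor⟩ := exists_diagonalize_of_transportMap_mul_eq hΩ hΩ' hlam hinj hτ h
  refine ⟨Finset.univ.filter fun i => d i ≠ 0, (rank_of_diagonalize hΩ hd).symm, fun j hj => ?_, ?_⟩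
  · have h1 := (Finset.mem_filter.1 hj).2
    have h2 := (hor j).resolve_left h1
    have h3 := (hd0 j).lt_of_ne' h1
    linarith
  · rw [hd]
    congr 3
    funext i
    by_cases hi : d i = 0
    · simp [excess, hi]
    · simp [excess, (hor i).resolve_left hi]

theorem candidate_mem_rankLE (Λ : Matrix (Fin n) (Fin n) ℝ) {J : Finset (Fin n)} (hJ : J.card = k)
    (V : Matrix (Fin m) (Fin k) ℝ) : candidate τ Ω Λ J hJ V ∈ rankLE n m k := by
  refine (Matrix.rank_mul_le_left _ _).trans ((Matrix.rank_mul_le_left _ _).trans ?_)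
  exact (Matrix.rank_le_width _)

theorem candidate_mem_rankEq (hΩ : Ωᵀ * Ω = 1) {J : Finset (Fin n)} (hJ : J.card = k)
    (h : ∀ j ∈ J, τ < lam j) {V : Matrix (Fin m) (Fin k) ℝ} (hV : Vᵀ * V = 1) :
    candidate τ Ω (Matrix.diagonal lam) J hJ V ∈ rankEq n m k := by
  have h1 := rank_of_diagonalize hΩ
    (candidate_mul_transpose (Ω := Ω) hJ (fun j hj => (h j hj).le) hV)
  refine h1.trans (Eq.trans (congrArg _ ?_) hJ)
  ext i
  rw [Finset.mem_filter]
  refine ⟨fun hi => ?_, fun hi => ⟨Finset.mem_univ i, ?_⟩⟩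
  · by_contra hiJ
    exact hi.2 (if_neg hiJ)
  · rw [excess, if_pos hi]
    exact (sub_pos.2 (h i hi)).ne'

theorem exists_transpose_mul_self_eq_one (hkm : k ≤ m) :
    ∃ V : Matrix (Fin m) (Fin k) ℝ, Vᵀ * V = 1 := by
  refine ⟨(1 : Matrix (Fin m) (Fin m) ℝ).submatrix id (Fin.castLE hkm), ?_⟩
  rw [Matrix.transpose_submatrix, Matrix.transpose_one,
    Matrix.submatrix_mul _ _ _ _ _ Function.bijective_id |>.symm, Matrix.one_mul,
    Matrix.submatrix_one _ (Fin.castLE_injective hkm)]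

/-- A minimizer is a fixed point with some index set `J`, possibly of fewer than `k` elements.
Comparing its loss with a candidate on the first `k` indices determines the covariance, though not
`J` itself when some `λ_i = τ`. -/
theorem covariance_of_isMinOn (hkn : k ≤ n) (hkm : k ≤ m) (hΩ : Ωᵀ * Ω = 1) (hΩ' : Ω * Ωᵀ = 1)
    (hlam : ∀ i, 0 < lam i) (hanti : StrictAnti lam) (hτ : 0 < τ)
    (hk : ∀ i : Fin n, (i : ℕ) < k → τ ≤ lam i) {W : Matrix (Fin n) (Fin m) ℝ}
    (hW : W ∈ rankLE n m k)
    (hmin : IsMinOn (smoothedLoss τ (Ω * Matrix.diagonal lam * Ωᵀ)) (rankLE n m k) W) :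
    W * Wᵀ = Ω * Matrix.diagonal (excess τ lam (firstIndices n k)) * Ωᵀ := by
  obtain ⟨J, hJ, hJτ, hJW⟩ := exists_excess_of_transportMap_mul_eq hΩ hΩ' hlam hanti.injective hτ
    (transportMap_mul_eq_of_isMinOn hτ (diagonalize_posDef hΩ hlam) hW hmin)
  obtain ⟨V, hV⟩ := exists_transpose_mul_self_eq_one hkm
  have hK : ∀ j ∈ firstIndices n k, τ ≤ lam j := fun j hj => hk j (mem_firstIndices.1 hj)
  have hle := hmin (candidate_mem_rankLE (τ := τ) (Ω := Ω) (Matrix.diagonal lam)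
    (card_firstIndices hkn) V)
  rw [Set.mem_ofPred_eq, smoothedLoss_of_excess hΩ hΩ' hlam hτ (fun j hj => (hJτ j hj).le) hJW,
    smoothedLoss_of_excess hΩ hΩ' hlam hτ hK
      (candidate_mul_transpose (card_firstIndices hkn) hK hV)] at hle
  rw [hJW, excess_eq_of_sum_le hτ hkn hanti hk (hJ.trans_le hW) hJτ hle]

theorem isLeast_smoothedLoss_rankLE (hkn : k ≤ n) (hkm : k ≤ m) (hΩ : Ωᵀ * Ω = 1)
    (hΩ' : Ω * Ωᵀ = 1) (hlam : ∀ i, 0 < lam i) (hanti : StrictAnti lam) (hτ : 0 < τ)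
    (hk : ∀ i : Fin n, (i : ℕ) < k → τ ≤ lam i) :
    IsLeast (smoothedLoss τ (Ω * Matrix.diagonal lam * Ωᵀ) '' rankLE n m k)
      (∑ j ∈ (firstIndices n k)ᶜ, (√(lam j) - √τ) ^ 2) := by
  obtain ⟨W, hW, hmin⟩ := exists_isMinOn_rankLE hτ (diagonalize_posDef hΩ hlam) m k
  have hval := smoothedLoss_of_excess hΩ hΩ' hlam hτ
    (fun j hj => hk j (mem_firstIndices.1 hj))
    (covariance_of_isMinOn hkn hkm hΩ hΩ' hlam hanti hτ hk hW hmin)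
  rw [← hval]
  refine ⟨Set.mem_image_of_mem _ hW, ?_⟩
  rintro _ ⟨X, hX, rfl⟩
  exact hmin hX

end Loss

end BuresWasserstein
end

/-! ### The main theorem -/

theorem mainTheorem2 {n m k : ℕ} (hkn : k ≤ n) (hkm : k ≤ m)
    (S₀ Ω : Matrix (Fin n) (Fin n) ℝ) (lam : Fin n → ℝ)
    (hΩ : Ω ∈ Matrix.orthogonalGroup (Fin n) ℝ)
    (hS₀ : S₀ = Ω * Matrix.diagonal lam * Ωᵀ)
    (hpos : ∀ i, 0 < lam i) (hanti : StrictAnti lam)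
    (τ : ℝ) (hτ : 0 < τ) :
    -- the critical points of the smoothed loss on the rank-`k` manifold
    (∀ W ∈ BuresWasserstein.rankEq n m k,
      BuresWasserstein.IsCriticalOnRank (BuresWasserstein.smoothedLoss τ S₀) k W ↔
        ∃ (J : Finset (Fin n)) (hJ : J.card = k) (V : Matrix (Fin m) (Fin k) ℝ),
          (∀ j ∈ J, τ ≤ lam j) ∧ Vᵀ * V = 1 ∧
            W = BuresWasserstein.candidate τ Ω (Matrix.diagonal lam) J hJ V) ∧
    -- the value of the loss at these points
    (∀ (J : Finset (Fin n)) (hJ : J.card = k) (V : Matrix (Fin m) (Fin k) ℝ),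
      (∀ j ∈ J, τ ≤ lam j) → Vᵀ * V = 1 →
        BuresWasserstein.smoothedLoss τ S₀
            (BuresWasserstein.candidate τ Ω (Matrix.diagonal lam) J hJ V) =
          ∑ j ∈ Jᶜ, (√(lam j) - √τ) ^ 2) ∧
    -- the minimum over rank at most `k`, and the minimizers
    ((∀ i : Fin n, (i : ℕ) < k → τ ≤ lam i) →
      IsLeast (BuresWasserstein.smoothedLoss τ S₀ '' BuresWasserstein.rankLE n m k)
        (∑ j ∈ (BuresWasserstein.firstIndices n k)ᶜ, (√(lam j) - √τ) ^ 2) ∧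
      ∀ W ∈ BuresWasserstein.rankLE n m k,
        IsMinOn (BuresWasserstein.smoothedLoss τ S₀) (BuresWasserstein.rankLE n m k) W ↔
          ∃ V : Matrix (Fin m) (Fin k) ℝ, Vᵀ * V = 1 ∧
            W = BuresWasserstein.candidate τ Ω (Matrix.diagonal lam)
              (BuresWasserstein.firstIndices n k) (BuresWasserstein.card_firstIndices hkn) V) ∧
    -- the infimum over rank exactly `k` is attained and equals the minimum over rank at most `k`
    ((∀ i : Fin n, (i : ℕ) < k → τ < lam i) →
      ∃ μ : ℝ,
        IsLeast (BuresWasserstein.smoothedLoss τ S₀ '' BuresWasserstein.rankEq n m k) μ ∧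
        IsLeast (BuresWasserstein.smoothedLoss τ S₀ '' BuresWasserstein.rankLE n m k) μ) := by
  have hΩ₁ : Ωᵀ * Ω = 1 := (Matrix.mem_orthogonalGroup_iff' (Fin n) ℝ).1 hΩ
  have hΩ₂ : Ω * Ωᵀ = 1 := (Matrix.mem_orthogonalGroup_iff (Fin n) ℝ).1 hΩ
  subst hS₀
  have hvalue : ∀ (J : Finset (Fin n)) (hJ : J.card = k) (V : Matrix (Fin m) (Fin k) ℝ),
      (∀ j ∈ J, τ ≤ lam j) → Vᵀ * V = 1 →
        BuresWasserstein.smoothedLoss τ (Ω * Matrix.diagonal lam * Ωᵀ)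
            (BuresWasserstein.candidate τ Ω (Matrix.diagonal lam) J hJ V) =
          ∑ j ∈ Jᶜ, (√(lam j) - √τ) ^ 2 := fun J hJ V hτJ hV =>
    BuresWasserstein.smoothedLoss_of_excess hΩ₁ hΩ₂ hpos hτ hτJ
      (BuresWasserstein.candidate_mul_transpose hJ hτJ hV)
  refine ⟨fun W hW => ?_, hvalue, fun hk => ?_, fun hk => ?_⟩
  · rw [BuresWasserstein.isCriticalOnRank_iff hτ
      (BuresWasserstein.diagonalize_posDef hΩ₁ hpos) hW]
    constructor
    · intro h
      obtain ⟨J, hJ, hJτ, hJW⟩ := BuresWasserstein.exists_excess_of_transportMap_mul_eq hΩ₁ hΩ₂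
        hpos hanti.injective hτ h
      have hτJ : ∀ j ∈ J, τ ≤ lam j := fun j hj => (hJτ j hj).le
      obtain ⟨V, hV, hWV⟩ :=
        BuresWasserstein.exists_eq_candidate hΩ₁ hΩ₂ hkm (hJ.trans hW) hτJ hJW
      exact ⟨J, hJ.trans hW, V, hτJ, hV, hWV⟩
    · rintro ⟨J, hJ, V, hτJ, hV, rfl⟩
      refine BuresWasserstein.transportMap_mul_eq_of_diagonalize hΩ₁ hΩ₂ hpos hτ
        (BuresWasserstein.excess_nonneg hτJ)
        (BuresWasserstein.candidate_mul_transpose hJ hτJ hV) fun i => ?_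
      by_cases hi : i ∈ J
      · exact Or.inr (if_pos hi)
      · exact Or.inl (if_neg hi)
  · have hK : ∀ j ∈ BuresWasserstein.firstIndices n k, τ ≤ lam j := fun j hj =>
      hk j (BuresWasserstein.mem_firstIndices.1 hj)
    have hleast := BuresWasserstein.isLeast_smoothedLoss_rankLE hkn hkm hΩ₁ hΩ₂ hpos hanti hτ hk
    refine ⟨hleast, fun W hW => ⟨fun hmin => ?_, ?_⟩⟩
    · exact BuresWasserstein.exists_eq_candidate hΩ₁ hΩ₂ hkm _ hK
        (BuresWasserstein.covariance_of_isMinOn hkn hkm hΩ₁ hΩ₂ hpos hanti hτ hk hW hmin)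
    · rintro ⟨V, hV, rfl⟩ X hX
      rw [Set.mem_ofPred_eq, hvalue _ _ V hK hV]
      exact hleast.2 (Set.mem_image_of_mem _ hX)
  · have hK : ∀ j ∈ BuresWasserstein.firstIndices n k, τ < lam j := fun j hj =>
      hk j (BuresWasserstein.mem_firstIndices.1 hj)
    have hleast := BuresWasserstein.isLeast_smoothedLoss_rankLE hkn hkm hΩ₁ hΩ₂ hpos hanti hτ
      fun i hi => (hk i hi).le
    obtain ⟨V, hV⟩ := BuresWasserstein.exists_transpose_mul_self_eq_one hkm
    -- Strictness gives the minimizing candidate rank exactly `k`, so the minimum over rank at most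
    -- `k` is already reached on the smaller set.
    refine ⟨_, ⟨⟨_, BuresWasserstein.candidate_mem_rankEq hΩ₁
      (BuresWasserstein.card_firstIndices hkn) hK hV, hvalue _ _ V (fun j hj => (hK j hj).le) hV⟩,
      ?_⟩, hleast⟩
    rintro _ ⟨X, hX, rfl⟩
    exact hleast.2 (Set.mem_image_of_mem _ (le_of_eq hX))
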